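/- Let $n,m,k$ be natural numbers, $1\le p<\infty$, $\frac1p+\frac1q=1$ (so $1<q\le\infty$). Let $X=W^{1,p}([0,1],\mathbb R^n)$ be the space of absolutely continuous $x:[0,1]\to\mathbb R^n$ with $\dot x\in L^p$, normed by $\|x(0)\|+\|\dot x\|_p$, let $U=L^p([0,1],\mathbb R^m)$, $W=\mathbb R^n\times L^p([0,1],\mathbb R^k)$, and let $\mathcal U\subset U$ be convex. Let $A,B,C$ be matrix-valued functions on $[0,1]$ of sizes $n\times n$, $n\times m$, $n\times k$, and let $g:\mathbb R^n\to\mathbb R$, $L:[0,1]\times\mathbb R^n\times\mathbb R^m\times\mathbb R^k\to\mathbb R$. For $w=(\alpha,\theta)\in W$ let $$V(w)=\inf\Big\{ g(x(1))+\int_0^1L(t,x(t),u(t),\theta(t))\,dt \;:\; (x,u)\in X\times\mathcal U,\ \dot x=Ax+Bu+C\theta \text{ a.e. on } [0,1],\ x(0)=\alpha\Big\}\in[-\infty,+\infty].$$ Assume: (A1) $A,B,C$ are measurable and essentially bounded. (A2) $g$ is convex and $C^1$; $L(\cdot,x,u,v)$ is measurable for all $(x,u,v)$; $L(t,\cdot,\cdot,\cdot)$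 is convex and $C^1$ for a.e. $t$; and there are constants $c_1,c_2>0$, $r\ge0$, $0\le p_1\le p$, $0\le p_2\le p-1$ and a nonnegative $w_1\in L^p([0,1],\mathbb R)$ with $|L(t,x,u,v)|\le c_1(w_1(t)+\|x\|^{p_1}+\|u\|^{p_1}+\|v\|^{p_1})$ and $\max\{|L_x|,|L_u|,|L_v|\}(t,x,u,v)\le c_2(\|x\|^{p_2}+\|u\|^{p_2}+\|v\|^{p_2})+r$ for all $(t,x,u,v)$. (A3) Every $v\in L^q([0,1],\mathbb R^n)$ with $C^Tv=0$ a.e. satisfies $\int_0^1A^Tv\,dt=0$, $B^Tv=0$ a.e., and $v(t)=-\int_0^tA^T(\tau)v(\tau)\,d\tau$ for a.e. $t$. (A4) The operator $W\times(X\times U)\to X$, $\big((\alpha,\theta),(x,u)\big)\mapsto x-\int_0^{(\cdot)}Ax\,d\tau-\int_0^{(\cdot)}Bu\,d\tau-\alpha-\int_0^{(\cdot)}C\theta\,d\tau$, has closed range. Moreover, let $\operatorname{int}\mathcal U\ne\emptyset$, let $V$ be finite at $\bar w=(\bar\alpha,\bar\theta)\in W$, and let $(\bar x,\bar u)$ be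 a solution of the minimization problem that defines $V(\bar w)$. For a convex set $\Omega$ in a normed space and $a\in\Omega$, let $N(a;\Omega)$ be the set of continuous linear functionals $\varphi$ with $\langle\varphi,x-a\rangle\le0$ for all $x\in\Omega$; let $\partial^\infty V(\bar w)$ be the set of $w^*\in W^*$ with $(w^*,0)\in N\big((\bar w,V(\bar w));\operatorname{epi}V\big)$. Identify $(\alpha^*,\theta^*)\in\mathbb R^n\times L^q([0,1],\mathbb R^k)$ with the functional $(\alpha,\theta)\mapsto\langle\alpha^*,\alpha\rangle+\int_0^1\langle\theta^*,\theta\rangle\,dt$ on $W$, and $u^*\in L^q([0,1],\mathbb R^m)$ with the functional $u\mapsto\int_0^1\langle u^*,u\rangle\,dt$ on $U$. Then for every $(\alpha^*,\theta^*)\in\mathbb R^n\times L^q([0,1],\mathbb R^k)$ the system $$\dot v(t)=-A^T(t)v(t)\ \text{ a.e. } t\in[0,1],\qquad v(0)=\alpha^*$$ has a unique solution $v\in W^{1,q}([0,1],\mathbb R^n)$, and $(\alpha^*,\theta^*)\in\partial^\infty V(\bar w)$ if and only if this solution $v$ satisfies $$\alpha^*=\int_0^1A^T(t)v(t)\,dt,\qquad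 \theta^*(t)=C^T(t)v(t)\ \text{ a.e. } t\in[0,1],$$ and the function $u^*\in L^q([0,1],\mathbb R^m)$, $u^*(t)=-B^T(t)v(t)$ a.e., belongs to $N(\bar u;\mathcal U)$. -/

import Mathlib

open MeasureTheory Set
open scoped ENNReal Matrix

noncomputable section

namespace OptControl

/-- Euclidean space of dimension `n`. -/
abbrev E (n : ℕ) : Type := EuclideanSpace ℝ (Fin n)

/-- Lebesgue measure on the interval `[0,1]`. -/
abbrev μI : Measure ℝ := volume.restrict (Icc (0 : ℝ) 1)

/-- The Lebesgue space of (classes of) `p`-integrable functions from `[0,1]` to `ℝⁿ`. -/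
abbrev LpE (n : ℕ) (p : ℝ≥0∞) : Type := Lp (E n) p μI

/-- The product of a matrix and a vector of a Euclidean space. -/
def mulE {a b : ℕ} (M : Matrix (Fin a) (Fin b) ℝ) (v : E b) : E a :=
  WithLp.toLp 2 (M *ᵥ v.ofLp)

/-! ### The Sobolev space of absolutely continuous functions with derivative in `L^p` -/

/-- A function on `[0,1]`, extended to the real line by its boundary values; only the values on
`[0,1]` matter below. -/
abbrev extendI {n : ℕ} (x : Icc (0 : ℝ) 1 → E n) : ℝ → E n := IccExtend zero_le_one x

theorem ae_differentiableAt {n : ℕ} {f : ℝ → E n} (hf : AbsolutelyContinuousOnInterval f 0 1) :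
    ∀ᵐ t ∂μI, DifferentiableAt ℝ f t := by
  rw [ae_restrict_iff' measurableSet_Icc]
  filter_upwards [hf.boundedVariationOn.ae_differentiableAt_of_mem_uIcc] with t ht h
  exact ht (by simpa using h)

/-- The absolutely continuous functions `x : [0,1] → ℝⁿ` with derivative in `L^p`. -/
def sobolev (n : ℕ) (p : ℝ≥0∞) : Submodule ℝ (Icc (0 : ℝ) 1 → E n) where
  carrier := {x | AbsolutelyContinuousOnInterval (extendI x) 0 1 ∧
    MemLp (deriv (extendI x)) p μI}
  zero_mem' := by
    have h : extendI (0 : Icc (0 : ℝ) 1 → E n) = fun _ => 0 := rfl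
    refine ⟨?_, ?_⟩
    · rw [h]
      exact ContDiffOn.absolutelyContinuousOnInterval contDiffOn_const
    · rw [h]; simp
  add_mem' := by
    rintro x y ⟨hx, hx'⟩ ⟨hy, hy'⟩
    have h : extendI (x + y) = extendI x + extendI y := rfl
    refine ⟨h ▸ hx.add hy, (hx'.add hy').ae_eq ?_⟩
    filter_upwards [ae_differentiableAt hx, ae_differentiableAt hy] with t h1 h2
    rw [h, deriv_add h1 h2]; rfl
  smul_mem' := by
    rintro c x ⟨hx, hx'⟩
    have h : extendI (c • x) = c • extendI x := rfl
    refine ⟨h ▸ hx.const_smul c, (hx'.const_smul c).ae_eq ?_⟩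
    filter_upwards [ae_differentiableAt hx] with t h1
    rw [h, deriv_const_smul c h1]; rfl

/-- The Sobolev space `W^{1,p}([0,1], ℝⁿ)`. -/
def W1 (n : ℕ) (p : ℝ≥0∞) : Type := sobolev n p

namespace W1

variable {n : ℕ} {p : ℝ≥0∞}

instance : AddCommGroup (W1 n p) := inferInstanceAs (AddCommGroup (sobolev n p))

instance : Module ℝ (W1 n p) := inferInstanceAs (Module ℝ (sobolev n p))

/-- Elements of the Sobolev space are used as functions of a real variable; only the values on
`[0,1]` matter. -/
instance : CoeFun (W1 n p) (fun _ => ℝ → E n) := ⟨fun x => extendI x.1⟩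

/-- The derivative of an element of `W^{1,p}`, as an element of `L^p`. -/
def derivLp (x : W1 n p) : LpE n p := x.2.2.toLp _

theorem derivLp_add (x y : W1 n p) : derivLp (x + y) = derivLp x + derivLp y := by
  apply Lp.ext
  refine (MemLp.coeFn_toLp _).trans (.trans ?_ (Lp.coeFn_add _ _).symm)
  filter_upwards [ae_differentiableAt x.2.1, ae_differentiableAt y.2.1,
    MemLp.coeFn_toLp x.2.2, MemLp.coeFn_toLp y.2.2] with t h1 h2 h3 h4
  have h : extendI (x + y).1 = extendI x.1 + extendI y.1 := rfl
  rw [Pi.add_apply, derivLp, derivLp, h3, h4, h, deriv_add h1 h2]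

theorem derivLp_smul (c : ℝ) (x : W1 n p) : derivLp (c • x) = c • derivLp x := by
  apply Lp.ext
  refine (MemLp.coeFn_toLp _).trans (.trans ?_ (Lp.coeFn_smul _ _).symm)
  filter_upwards [ae_differentiableAt x.2.1, MemLp.coeFn_toLp x.2.2] with t h1 h3
  have h : extendI (c • x).1 = c • extendI x.1 := rfl
  rw [Pi.smul_apply, derivLp, h3, h, deriv_const_smul c h1]

theorem eq_zero_of (x : W1 n p) (h0 : x 0 = 0) (h1 : derivLp x = 0) : x = 0 := by
  have hd : ∀ᵐ t, t ∈ uIcc (0 : ℝ) 1 → HasDerivAt (extendI x.1) 0 t := by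
    have h2 : ∀ᵐ t ∂μI, HasDerivAt (extendI x.1) 0 t := by
      have h3' : derivLp x =ᵐ[μI] 0 := by rw [h1]; exact Lp.coeFn_zero _ _ _
      have h3 : deriv (extendI x.1) =ᵐ[μI] 0 := (MemLp.coeFn_toLp x.2.2).symm.trans h3'
      filter_upwards [ae_differentiableAt x.2.1, h3] with t h4 h5
      have h6 := h4.hasDerivAt
      rwa [h5] at h6
    rw [ae_restrict_iff' measurableSet_Icc] at h2
    filter_upwards [h2] with t ht h
    exact ht (by simpa using h)
  obtain ⟨c, hc⟩ := x.2.1.const_of_ae_hasDerivAt_zero hd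
  have hc0 : c = 0 := by rw [← hc 0 (by simp)]; exact h0
  apply Subtype.ext
  funext t
  have h7 : extendI x.1 t = c := hc t (by simp)
  have h8 : extendI x.1 t = x.1 t := IccExtend_val _ _ _
  rw [← h8, h7, hc0]; rfl

/-- The norm `‖x(0)‖ + ‖ẋ‖_p`. -/
instance [Fact (1 ≤ p)] : NormedAddCommGroup (W1 n p) :=
  AddGroupNorm.toNormedAddCommGroup
    { toFun := fun x => ‖x 0‖ + ‖derivLp x‖
      map_zero' := by
        have h : derivLp (0 : W1 n p) = 0 := by simpa using derivLp_smul 0 (0 : W1 n p)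
        have h' : (0 : W1 n p) 0 = 0 := rfl
        rw [h, h']; simp
      add_le' := by
        intro x y
        have h' : (x + y) 0 = x 0 + y 0 := rfl
        rw [derivLp_add, h']
        linarith [norm_add_le (x 0) (y 0), norm_add_le (derivLp x) (derivLp y)]
      neg' := by
        intro x
        have h : derivLp (-x) = -derivLp x := by simpa using derivLp_smul (-1) x
        have h' : (-x) 0 = -(x 0) := rfl
        rw [h, h', norm_neg, norm_neg]
      eq_zero_of_map_eq_zero' := by
        intro x h
        have h1 := norm_nonneg (x 0)
        have h2 := norm_nonneg (derivLp x)
        exact eq_zero_of x (norm_eq_zero.1 (by linarith)) (norm_eq_zero.1 (by linarith)) }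

theorem norm_def [Fact (1 ≤ p)] (x : W1 n p) : ‖x‖ = ‖x 0‖ + ‖derivLp x‖ := rfl

instance [Fact (1 ≤ p)] : NormedSpace ℝ (W1 n p) where
  norm_smul_le c x := by
    have h' : (c • x) 0 = c • x 0 := rfl
    rw [norm_def, norm_def, derivLp_smul, h', norm_smul, norm_smul, mul_add]

end W1

/-! ### Convex analysis -/

/-- The normal cone of a set `Ω` at a point `a` of `Ω`. -/
def normalCone {X : Type*} [NormedAddCommGroup X] [NormedSpace ℝ X] (a : X) (Ω : Set X) :
    Set (StrongDual ℝ X) :=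
  {φ | ∀ x ∈ Ω, φ (x - a) ≤ 0}

/-- The epigraph of an extended real-valued function. -/
def epigraph {X : Type*} (f : X → EReal) : Set (X × ℝ) := {z | f z.1 ≤ (z.2 : EReal)}

/-- The singular subdifferential of an extended real-valued function at `a`: the functionals
`φ` such that `(φ, 0)` is normal to the epigraph at `(a, f a)`; it is empty outside the effective
domain. -/
def singularSubdifferential {X : Type*} [NormedAddCommGroup X] [NormedSpace ℝ X]
    (f : X → EReal) (a : X) : Set (StrongDual ℝ X) :=
  {φ | f a < ⊤ ∧
    φ.coprod (0 : StrongDual ℝ ℝ) ∈ normalCone (a, (f a).toReal) (epigraph f)}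

/-! ### Dual pairings -/

section Duality

variable {n k : ℕ} {p q : ℝ≥0∞} [Fact (1 ≤ p)] [Fact (1 ≤ q)] [q.HolderConjugate p]

/-- The functional on `L^p` represented by an element of `L^q`. -/
def LpFunctional (p : ℝ≥0∞) [Fact (1 ≤ p)] [q.HolderConjugate p] (f : LpE n q) :
    StrongDual ℝ (LpE n p) :=
  ContinuousLinearMap.lpPairing μI q p
    (LinearMap.mkContinuous₂ (innerₗ (E n)) 1
      (fun x y => by simpa using norm_inner_le_norm (𝕜 := ℝ) x y)) f

theorem LpFunctional_apply (f : LpE n q) (x : LpE n p) :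
    LpFunctional p f x = ∫ t in (0 : ℝ)..1, inner ℝ (f t) (x t) := by
  rw [LpFunctional, ContinuousLinearMap.lpPairing_eq_integral,
    intervalIntegral.integral_of_le zero_le_one, integral_Icc_eq_integral_Ioc]
  rfl

/-- The functional `(α, θ) ↦ ⟨a, α⟩ + ∫ ⟨f, θ⟩` on `ℝⁿ × L^p` represented by the pair `(a, f)` of
`ℝⁿ × L^q`. -/
def pairFunctional (p : ℝ≥0∞) [Fact (1 ≤ p)] [q.HolderConjugate p] (a : E n) (f : LpE k q) :
    StrongDual ℝ (E n × LpE k p) :=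
  (innerSL ℝ a).coprod (LpFunctional p f)

theorem pairFunctional_apply (a : E n) (f : LpE k q) (w : E n × LpE k p) :
    pairFunctional p a f w = inner ℝ a w.1 + ∫ t in (0 : ℝ)..1, inner ℝ (f t) (w.2 t) := by
  rw [← LpFunctional_apply]; rfl

end Duality

/-! ### The parametric optimal control problem -/

section Problem

variable {n m k : ℕ} {p : ℝ≥0∞}

/-- The objective function `g(x(1)) + ∫₀¹ L(t, x(t), u(t), θ(t)) dt`. -/
def cost (g : E n → ℝ) (L : ℝ → E n → E m → E k → ℝ)
    (z : W1 n p × LpE m p) (w : E n × LpE k p) : ℝ :=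
  g (z.1 1) + ∫ t in (0 : ℝ)..1, L t (z.1 t) (z.2 t) (w.2 t)

/-- The pairs `(x, u)` with `ẋ = A x + B u + C θ` almost everywhere and `x(0) = α`, where
`w = (α, θ)`. -/
def dynamicsSet (A : ℝ → Matrix (Fin n) (Fin n) ℝ) (B : ℝ → Matrix (Fin n) (Fin m) ℝ)
    (C : ℝ → Matrix (Fin n) (Fin k) ℝ) (w : E n × LpE k p) : Set (W1 n p × LpE m p) :=
  {z | (∀ᵐ t ∂μI, deriv z.1 t = mulE (A t) (z.1 t) + mulE (B t) (z.2 t) + mulE (C t) (w.2 t)) ∧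
    z.1 0 = w.1}

/-- The feasible pairs: solutions of the dynamics whose control lies in `𝒰`. -/
def feasibleSet (A : ℝ → Matrix (Fin n) (Fin n) ℝ) (B : ℝ → Matrix (Fin n) (Fin m) ℝ)
    (C : ℝ → Matrix (Fin n) (Fin k) ℝ) (𝒰 : Set (LpE m p)) (w : E n × LpE k p) :
    Set (W1 n p × LpE m p) :=
  dynamicsSet A B C w ∩ univ ×ˢ 𝒰

/-- The optimal value function. -/
def optimalValue (A : ℝ → Matrix (Fin n) (Fin n) ℝ) (B : ℝ → Matrix (Fin n) (Fin m) ℝ)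
    (C : ℝ → Matrix (Fin n) (Fin k) ℝ) (g : E n → ℝ) (L : ℝ → E n → E m → E k → ℝ)
    (𝒰 : Set (LpE m p)) (w : E n × LpE k p) : EReal :=
  ⨅ z ∈ feasibleSet A B C 𝒰 w, (cost g L z w : EReal)

/-- The set of optimal solutions. -/
def solutionSet (A : ℝ → Matrix (Fin n) (Fin n) ℝ) (B : ℝ → Matrix (Fin n) (Fin m) ℝ)
    (C : ℝ → Matrix (Fin n) (Fin k) ℝ) (g : E n → ℝ) (L : ℝ → E n → E m → E k → ℝ)
    (𝒰 : Set (LpE m p)) (w : E n × LpE k p) : Set (W1 n p × LpE m p) :=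
  {z | z ∈ feasibleSet A B C 𝒰 w ∧ ∀ z' ∈ feasibleSet A B C 𝒰 w, cost g L z w ≤ cost g L z' w}

/-- A matrix-valued function is (Lebesgue) measurable and essentially bounded on `[0,1]`. -/
def MeasEssBounded {a b : ℕ} (M : ℝ → Matrix (Fin a) (Fin b) ℝ) : Prop :=
  (∀ i j, AEMeasurable (fun t => M t i j) μI) ∧
    ∃ γ > (0 : ℝ), ∀ᵐ t ∂μI, ∀ i j, |M t i j| ≤ γ

/-- Regularity, convexity and growth of the cost functions. -/
structure CostAssumption (p : ℝ≥0∞) (g : E n → ℝ) (L : ℝ → E n → E m → E k → ℝ) : Prop where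
  convex_g : ConvexOn ℝ univ g
  contDiff_g : ContDiff ℝ 1 g
  measurable_L : ∀ x u v, AEMeasurable (fun t => L t x u v) μI
  convex_L : ∀ᵐ t ∂μI, ConvexOn ℝ univ (fun z : E n × E m × E k => L t z.1 z.2.1 z.2.2)
  contDiff_L : ∀ᵐ t ∂μI, ContDiff ℝ 1 (fun z : E n × E m × E k => L t z.1 z.2.1 z.2.2)
  growth : ∃ c₁ c₂ r p₁ p₂ : ℝ, ∃ w₁ : ℝ → ℝ,
    0 < c₁ ∧ 0 < c₂ ∧ 0 ≤ r ∧ 0 ≤ p₁ ∧ p₁ ≤ p.toReal ∧ 0 ≤ p₂ ∧ p₂ ≤ p.toReal - 1 ∧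
    MemLp w₁ p μI ∧ (∀ t ∈ Icc (0 : ℝ) 1, 0 ≤ w₁ t) ∧
    ∀ t ∈ Icc (0 : ℝ) 1, ∀ (x : E n) (u : E m) (v : E k),
      |L t x u v| ≤ c₁ * (w₁ t + ‖x‖ ^ p₁ + ‖u‖ ^ p₁ + ‖v‖ ^ p₁) ∧
      max ‖gradient (fun x' => L t x' u v) x‖
        (max ‖gradient (fun u' => L t x u' v) u‖ ‖gradient (fun v' => L t x u v') v‖) ≤
        c₂ * (‖x‖ ^ p₂ + ‖u‖ ^ p₂ + ‖v‖ ^ p₂) + r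

/-- The kernel of `v ↦ Cᵀ v` on `L^q` is contained in the kernel of `v ↦ ∫₀¹ Aᵀ v`, in the kernel
of `v ↦ -Bᵀ v` and in the set of fixed points of `v ↦ -∫₀^(·) Aᵀ v`. -/
def KernelAssumption (q : ℝ≥0∞) (A : ℝ → Matrix (Fin n) (Fin n) ℝ)
    (B : ℝ → Matrix (Fin n) (Fin m) ℝ) (C : ℝ → Matrix (Fin n) (Fin k) ℝ) : Prop :=
  ∀ v : LpE n q, (∀ᵐ t ∂μI, mulE (C t)ᵀ (v t) = 0) →
    (∫ t in (0 : ℝ)..1, mulE (A t)ᵀ (v t)) = 0 ∧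
    (∀ᵐ t ∂μI, -mulE (B t)ᵀ (v t) = 0) ∧
    (∀ᵐ t ∂μI, -(∫ τ in (0 : ℝ)..t, mulE (A τ)ᵀ (v τ)) = v t)

/-- The operator `(w, z) ↦ x - ∫₀^(·) A x - ∫₀^(·) B u - α - ∫₀^(·) C θ`, where `w = (α, θ)` and
`z = (x, u)`. -/
def stateOperator (A : ℝ → Matrix (Fin n) (Fin n) ℝ) (B : ℝ → Matrix (Fin n) (Fin m) ℝ)
    (C : ℝ → Matrix (Fin n) (Fin k) ℝ) (w : E n × LpE k p) (z : W1 n p × LpE m p) : ℝ → E n :=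
  fun t => z.1 t - (∫ τ in (0 : ℝ)..t, mulE (A τ) (z.1 τ))
    - (∫ τ in (0 : ℝ)..t, mulE (B τ) (z.2 τ)) - w.1 - ∫ τ in (0 : ℝ)..t, mulE (C τ) (w.2 τ)

/-- The range of the operator above is closed in the Sobolev space `W^{1,p}`. -/
def ClosedRangeAssumption (p : ℝ≥0∞) [Fact (1 ≤ p)] (A : ℝ → Matrix (Fin n) (Fin n) ℝ)
    (B : ℝ → Matrix (Fin n) (Fin m) ℝ) (C : ℝ → Matrix (Fin n) (Fin k) ℝ) : Prop :=
  IsClosed {y : W1 n p | ∃ (w : E n × LpE k p) (z : W1 n p × LpE m p),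
    ∀ t ∈ Icc (0 : ℝ) 1, y t = stateOperator A B C w z t}

/-- `v` solves the adjoint system `v̇ = -Aᵀ v` almost everywhere, `v(0) = a`. -/
def IsAdjointSolution {q : ℝ≥0∞} (A : ℝ → Matrix (Fin n) (Fin n) ℝ) (a : E n) (v : W1 n q) :
    Prop :=
  (∀ᵐ t ∂μI, deriv v t = -mulE (A t)ᵀ (v t)) ∧ v 0 = a

end Problem

end OptControl

end

/-!
The theorem holds because both sides of the equivalence say that `(α*, θ*) = 0`.

*The singular subdifferential is `{0}`.* The linear equation `ẋ = A x + B u + C θ`, `x(0) = α` with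
bounded measurable coefficients has a solution in `W^{1,p}` for all `u`, `α` and `θ`
(`exists_linear_solution`: an iterate of the Picard operator on `C([0,1])` is a contraction). As the
cost of a feasible pair is finite and `𝒰` is nonempty, the value function is `< ⊤` on all of `W`
(`optimalValue_lt_top`). A functional `w*` for which `(w*, 0)` is normal to the epigraph is normal
to the effective domain, here the whole space, and therefore zero
(`singularSubdifferential_eq_zero`). A pair `(α*, θ*)` representing the zero functional is zero
(`eq_zero_of_pairFunctional_eq_zero`).

*The adjoint conditions force `(α*, θ*) = 0`.* The solution of `v̇ = -Aᵀ v`, `v(0) = α*` satisfies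
`v(1) = α* - ∫₀¹ Aᵀ v`, so the condition `α* = ∫₀¹ Aᵀ v` means `v(1) = 0`. Backward uniqueness, a
Grönwall estimate for the reversed curve, gives `v = 0` (`IsAdjointSolution.eq_zero`), hence
`α* = v(0) = 0` and `θ* = Cᵀ v = 0`. Conversely `v = 0` fulfils all conditions when
`(α*, θ*) = 0`, since `0` lies in every normal cone.
-/

namespace OptControl

/-! ### Essentially bounded matrix functions -/

section Matrices

variable {a b : ℕ}

theorem mulE_sub (M : Matrix (Fin a) (Fin b) ℝ) (v w : E b) :
    mulE M (v - w) = mulE M v - mulE M w := by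
  simp [mulE, Matrix.mulVec_sub]

theorem mulE_zero (M : Matrix (Fin a) (Fin b) ℝ) : mulE M (0 : E b) = 0 := by
  simp [mulE]

theorem norm_mulE_le {M : Matrix (Fin a) (Fin b) ℝ} {γ : ℝ} (hM : ∀ i j, |M i j| ≤ γ) (v : E b) :
    ‖mulE M v‖ ≤ a * (b * γ) * ‖v‖ := by
  have hrow (i : Fin a) : ‖mulE M v i‖ ≤ b * γ * ‖v‖ := by
    calc ‖mulE M v i‖ = ‖∑ j, M i j * v j‖ := rfl
      _ ≤ ∑ j, ‖M i j * v j‖ := norm_sum_le _ _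
      _ ≤ ∑ _j : Fin b, γ * ‖v‖ := by
          refine Finset.sum_le_sum fun j _ => ?_
          rw [norm_mul]
          exact mul_le_mul (hM i j) (PiLp.norm_apply_le v j) (norm_nonneg _)
            ((abs_nonneg _).trans (hM i j))
      _ = b * γ * ‖v‖ := by simp [mul_assoc]
  calc ‖mulE M v‖ = ‖∑ i, mulE M v i • EuclideanSpace.basisFun (Fin a) ℝ i‖ := by
        conv_lhs => rw [← (EuclideanSpace.basisFun (Fin a) ℝ).sum_repr (mulE M v)]
        simp
    _ ≤ ∑ i, ‖mulE M v i • EuclideanSpace.basisFun (Fin a) ℝ i‖ := norm_sum_le _ _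
    _ ≤ ∑ _i : Fin a, b * γ * ‖v‖ := by
        refine Finset.sum_le_sum fun i _ => ?_
        rw [norm_smul, OrthonormalBasis.norm_eq_one, mul_one]
        exact hrow i
    _ = a * (b * γ) * ‖v‖ := by simp [mul_assoc]

theorem MeasEssBounded.exists_norm_mulE_le {M : ℝ → Matrix (Fin a) (Fin b) ℝ}
    (hM : MeasEssBounded M) : ∃ K : ℝ, 0 ≤ K ∧ ∀ᵐ t ∂μI, ∀ v, ‖mulE (M t) v‖ ≤ K * ‖v‖ := by
  obtain ⟨-, γ, hγ, h⟩ := hM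
  exact ⟨a * (b * γ), by positivity, h.mono fun t ht v => norm_mulE_le ht v⟩

theorem MeasEssBounded.transpose {M : ℝ → Matrix (Fin a) (Fin b) ℝ} (hM : MeasEssBounded M) :
    MeasEssBounded fun t => (M t)ᵀ := by
  obtain ⟨h, γ, hγ, h'⟩ := hM
  exact ⟨fun i j => h j i, γ, hγ, h'.mono fun t ht i j => ht j i⟩

theorem MeasEssBounded.neg {M : ℝ → Matrix (Fin a) (Fin b) ℝ} (hM : MeasEssBounded M) :
    MeasEssBounded fun t => -M t := by
  obtain ⟨h, γ, hγ, h'⟩ := hM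
  exact ⟨fun i j => (h i j).neg, γ, hγ, h'.mono fun t ht i j => by simpa using ht i j⟩

theorem MeasEssBounded.aestronglyMeasurable_mulE {M : ℝ → Matrix (Fin a) (Fin b) ℝ}
    (hM : MeasEssBounded M) {f : ℝ → E b} (hf : AEStronglyMeasurable f μI) :
    AEStronglyMeasurable (fun t => mulE (M t) (f t)) μI := by
  have hf' (j : Fin b) : AEMeasurable (fun t => f t j) μI :=
    ((EuclideanSpace.proj (𝕜 := ℝ) j).continuous.comp_aestronglyMeasurable hf).aemeasurable
  refine AEMeasurable.aestronglyMeasurable ((WithLp.measurable_toLp 2 _).comp_aemeasurable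
    (aemeasurable_pi_lambda _ fun i => ?_))
  exact Finset.aemeasurable_fun_sum (Finset.univ : Finset (Fin b))
    fun j _ => (hM.1 i j).mul (hf' j)

theorem MeasEssBounded.memLp_mulE {M : ℝ → Matrix (Fin a) (Fin b) ℝ} (hM : MeasEssBounded M)
    {p : ℝ≥0∞} {f : ℝ → E b} (hf : MemLp f p μI) : MemLp (fun t => mulE (M t) (f t)) p μI := by
  obtain ⟨K, -, hK⟩ := hM.exists_norm_mulE_le
  exact hf.of_le_mul (hM.aestronglyMeasurable_mulE hf.1) (hK.mono fun t ht => ht (f t))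

end Matrices

/-! ### Primitives and the fundamental theorem of calculus -/

section Primitives

variable {n : ℕ} {p : ℝ≥0∞}

theorem memLp_μI_intervalIntegrable [Fact (1 ≤ p)] {f : ℝ → E n} (hf : MemLp f p μI) :
    IntervalIntegrable f volume 0 1 := by
  rw [intervalIntegrable_iff_integrableOn_Icc_of_le zero_le_one]
  exact hf.integrable Fact.out

theorem intervalIntegrable_of_mem {f : ℝ → E n} (hf : IntervalIntegrable f volume 0 1) {s t : ℝ}
    (hs : s ∈ Icc (0 : ℝ) 1) (ht : t ∈ Icc (0 : ℝ) 1) : IntervalIntegrable f volume s t :=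
  hf.mono_set (by rw [uIcc_of_le zero_le_one]; exact uIcc_subset_Icc hs ht)

/-- The indefinite integral of an integrable vector-valued function is absolutely continuous: its
increments are dominated by those of the indefinite integral of the norm, for which the scalar
statement applies. -/
theorem absolutelyContinuousOnInterval_primitive {f : ℝ → E n}
    (hf : IntervalIntegrable f volume 0 1) :
    AbsolutelyContinuousOnInterval (fun t => ∫ τ in (0 : ℝ)..t, f τ) 0 1 := by
  have hG := hf.norm.absolutelyContinuousOnInterval_intervalIntegral (c := 0) (by simp)
  rw [absolutelyContinuousOnInterval_iff] at hG ⊢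
  intro ε hε
  obtain ⟨δ, hδ, h⟩ := hG ε hε
  refine ⟨δ, hδ, fun I hI hlen => lt_of_le_of_lt (Finset.sum_le_sum fun i hi => ?_) (h I hI hlen)⟩
  have hmem := hI.1 i hi
  rw [uIcc_of_le zero_le_one] at hmem
  have h0 : (0 : ℝ) ∈ Icc (0 : ℝ) 1 := by simp
  rw [dist_eq_norm, dist_eq_norm,
    intervalIntegral.integral_interval_sub_left (intervalIntegrable_of_mem hf h0 hmem.1)
      (intervalIntegrable_of_mem hf h0 hmem.2),
    intervalIntegral.integral_interval_sub_left (intervalIntegrable_of_mem hf h0 hmem.1).norm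
      (intervalIntegrable_of_mem hf h0 hmem.2).norm]
  exact intervalIntegral.norm_integral_le_abs_integral_norm

theorem ae_hasDerivAt_primitive {f : ℝ → E n} (hf : IntervalIntegrable f volume 0 1) :
    ∀ᵐ t ∂μI, HasDerivAt (fun t => ∫ τ in (0 : ℝ)..t, f τ) (f t) t := by
  rw [ae_restrict_iff' measurableSet_Icc]
  filter_upwards [hf.ae_hasDerivAt_integral] with t ht h
  exact ht (by simpa using h) 0 (by simp)

theorem _root_.AbsolutelyContinuousOnInterval.congr_Icc {f g : ℝ → E n}
    (hf : AbsolutelyContinuousOnInterval f 0 1) (h : EqOn f g (Icc 0 1)) :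
    AbsolutelyContinuousOnInterval g 0 1 := by
  rw [absolutelyContinuousOnInterval_iff] at hf ⊢
  intro ε hε
  obtain ⟨δ, hδ, hf⟩ := hf ε hε
  refine ⟨δ, hδ, fun I hI hlen => ?_⟩
  refine lt_of_le_of_lt (Finset.sum_le_sum fun i hi => ?_) (hf I hI hlen)
  have hmem := hI.1 i hi
  rw [uIcc_of_le zero_le_one] at hmem
  rw [h hmem.1, h hmem.2]

theorem extendI_eq {x : Icc (0 : ℝ) 1 → E n} {t : ℝ} (ht : t ∈ Icc (0 : ℝ) 1) :
    extendI x t = x ⟨t, ht⟩ :=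
  IccExtend_of_mem _ _ ht

theorem ae_μI_mem_Ioo : ∀ᵐ t ∂μI, t ∈ Ioo (0 : ℝ) 1 := by
  rw [μI, ← restrict_Ioo_eq_restrict_Icc]
  exact ae_restrict_mem measurableSet_Ioo

/-- A function with `x t = a + ∫₀ᵗ h` on `[0,1]`, where `h ∈ L^p`, belongs to `W^{1,p}` and has
derivative `h`. -/
theorem exists_W1_of_primitive [Fact (1 ≤ p)] (x : Icc (0 : ℝ) 1 → E n) {a : E n} {h : ℝ → E n}
    (hh : MemLp h p μI)
    (hx : ∀ t ∈ Icc (0 : ℝ) 1, extendI x t = a + ∫ τ in (0 : ℝ)..t, h τ) :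
    ∃ y : W1 n p, y.1 = x ∧ ∀ᵐ t ∂μI, deriv y t = h t := by
  have hi := memLp_μI_intervalIntegrable hh
  have hderiv : ∀ᵐ t ∂μI, deriv (extendI x) t = h t := by
    -- `extendI x` is constant outside `[0,1]`, so the two derivatives need only agree in `(0,1)`.
    filter_upwards [ae_hasDerivAt_primitive hi, ae_μI_mem_Ioo] with t ht hmem
    refine ((ht.const_add a).congr_of_eventuallyEq ?_).deriv
    filter_upwards [Icc_mem_nhds hmem.1 hmem.2] with s hs using hx s hs
  have hac : AbsolutelyContinuousOnInterval (extendI x) 0 1 := by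
    have hconst : AbsolutelyContinuousOnInterval (fun _ : ℝ => a) 0 1 :=
      ContDiffOn.absolutelyContinuousOnInterval contDiffOn_const
    exact (hconst.add (absolutelyContinuousOnInterval_primitive hi)).congr_Icc
      fun t ht => (hx t ht).symm
  exact ⟨⟨x, hac, hh.ae_eq (hderiv.mono fun t ht => ht.symm)⟩, rfl, hderiv⟩

theorem W1.continuous (x : W1 n p) : Continuous (x : ℝ → E n) := by
  have h : ContinuousOn (extendI x.1) (Icc 0 1) := by
    have h := x.2.1.continuousOn
    rwa [uIcc_of_le zero_le_one] at h
  refine Continuous.Icc_extend' ?_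
  have h' := h.domRestrict
  refine h'.congr fun t => ?_
  exact IccExtend_val _ _ _

theorem W1.eq_add_integral_deriv [Fact (1 ≤ p)] (x : W1 n p) {t : ℝ} (ht : t ∈ Icc (0 : ℝ) 1) :
    x t = x 0 + ∫ τ in (0 : ℝ)..t, deriv x τ := by
  have hi := memLp_μI_intervalIntegrable x.2.2
  have hac := x.2.1.sub (absolutelyContinuousOnInterval_primitive hi)
  have hd : ∀ᵐ t ∂μI, HasDerivAt
      ((extendI x.1) - fun t => ∫ τ in (0 : ℝ)..t, deriv (extendI x.1) τ) 0 t := by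
    filter_upwards [ae_differentiableAt x.2.1, ae_hasDerivAt_primitive hi] with t h1 h2
    simpa using h1.hasDerivAt.sub h2
  rw [ae_restrict_iff' measurableSet_Icc] at hd
  obtain ⟨c, hc⟩ := hac.const_of_ae_hasDerivAt_zero
    (hd.mono fun t ht h => ht (by rwa [uIcc_of_le zero_le_one] at h))
  rw [uIcc_of_le zero_le_one] at hc
  have h0 := hc 0 (by simp)
  have h1 := hc t ht
  simp only [Pi.sub_apply, intervalIntegral.integral_same, sub_zero] at h0 h1
  rw [h0, ← h1]
  abel

theorem W1.ext_of_eqOn {x y : W1 n p} (h : ∀ t ∈ Icc (0 : ℝ) 1, x t = y t) : x = y := by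
  refine Subtype.ext (funext fun t => ?_)
  have h' := h t t.2
  rwa [extendI_eq t.2, extendI_eq t.2] at h'

end Primitives

/-! ### Linear differential equations with bounded measurable coefficients -/

section LinearODE

variable {n : ℕ} {p : ℝ≥0∞}

/-- Grönwall's inequality in integral form with zero initial value, applied to the primitive of
`φ`. -/
theorem eq_zero_of_le_mul_integral {φ : ℝ → ℝ} (hφ : Continuous φ) (h0 : ∀ t, 0 ≤ φ t) {K : ℝ}
    (h : ∀ t ∈ Icc (0 : ℝ) 1, φ t ≤ K * ∫ s in (0 : ℝ)..t, φ s) :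
    ∀ t ∈ Icc (0 : ℝ) 1, φ t = 0 := by
  have hd (t : ℝ) : HasDerivAt (fun t => ∫ s in (0 : ℝ)..t, φ s) (φ t) t :=
    intervalIntegral.integral_hasDerivAt_right (hφ.intervalIntegrable _ _)
      (hφ.stronglyMeasurableAtFilter _ _) hφ.continuousAt
  have hz := eq_zero_of_abs_deriv_le_mul_abs_self_of_eq_zero_right (K := K) (a := 0) (b := 1)
    (fun t _ => (hd t).continuousAt.continuousWithinAt) (fun t _ => (hd t).hasDerivWithinAt)
    (by simp) fun t ht => by
      rw [Real.norm_of_nonneg (h0 t), Real.norm_of_nonneg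
        (intervalIntegral.integral_nonneg ht.1 fun s _ => h0 s)]
      exact h t ⟨ht.1, ht.2.le⟩
  intro t ht
  exact le_antisymm (by simpa [hz t ht] using h t ht) (h0 t)

theorem norm_integral_deriv_le {A : ℝ → Matrix (Fin n) (Fin n) ℝ} {x : W1 n p}
    {K : ℝ} (hK : ∀ᵐ t ∂μI, ∀ v, ‖mulE (A t) v‖ ≤ K * ‖v‖)
    (hx : ∀ᵐ t ∂μI, deriv x t = mulE (A t) (x t)) {s t : ℝ} (hs : 0 ≤ s) (hst : s ≤ t)
    (ht : t ≤ 1) :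
    ‖∫ τ in s..t, deriv x τ‖ ≤ K * ∫ τ in s..t, ‖x τ‖ := by
  rw [← intervalIntegral.integral_const_mul]
  refine intervalIntegral.norm_integral_le_of_norm_le hst ?_
    ((x.continuous.norm.const_mul K).intervalIntegrable _ _)
  have h : ∀ᵐ τ ∂μI, ‖deriv x τ‖ ≤ K * ‖x τ‖ := by
    filter_upwards [hK, hx] with τ h1 h2
    rw [h2]
    exact h1 _
  rw [ae_restrict_iff' measurableSet_Icc] at h
  filter_upwards [h] with τ hτ hmem
  exact hτ ⟨hs.trans hmem.1.le, hmem.2.trans ht⟩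

/-- Forward uniqueness for a homogeneous linear equation. -/
theorem eq_zero_of_linear_of_left [Fact (1 ≤ p)] {A : ℝ → Matrix (Fin n) (Fin n) ℝ}
    (hA : MeasEssBounded A) {x : W1 n p} (hx : ∀ᵐ t ∂μI, deriv x t = mulE (A t) (x t))
    (h0 : x 0 = 0) : x = 0 := by
  obtain ⟨K, -, hK⟩ := hA.exists_norm_mulE_le
  refine W1.ext_of_eqOn fun t ht => norm_eq_zero.1 ?_
  refine eq_zero_of_le_mul_integral x.continuous.norm (fun t => norm_nonneg _) (K := K)
    (fun t ht => ?_) t ht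
  rw [x.eq_add_integral_deriv ht, h0, zero_add]
  exact norm_integral_deriv_le hK hx le_rfl ht.1 ht.2

/-- Backward uniqueness: the estimate of the forward case applies to the reversed curve
`t ↦ x (1 - t)`. -/
theorem eq_zero_of_linear_of_right [Fact (1 ≤ p)] {A : ℝ → Matrix (Fin n) (Fin n) ℝ}
    (hA : MeasEssBounded A) {x : W1 n p} (hx : ∀ᵐ t ∂μI, deriv x t = mulE (A t) (x t))
    (h1 : x 1 = 0) : x = 0 := by
  obtain ⟨K, -, hK⟩ := hA.exists_norm_mulE_le
  have hrev : ∀ t ∈ Icc (0 : ℝ) 1, ‖x (1 - t)‖ = 0 := by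
    refine eq_zero_of_le_mul_integral (K := K)
      (x.continuous.comp (continuous_const.sub continuous_id)).norm (fun t => norm_nonneg _)
      fun t ht => ?_
    have hs : 1 - t ∈ Icc (0 : ℝ) 1 := ⟨by linarith [ht.2], by linarith [ht.1]⟩
    have h01 : (0 : ℝ) ∈ Icc (0 : ℝ) 1 := by simp
    have h11 : (1 : ℝ) ∈ Icc (0 : ℝ) 1 := by simp
    have hi := memLp_μI_intervalIntegrable x.2.2
    have hsplit := intervalIntegral.integral_add_adjacent_intervals
      (intervalIntegrable_of_mem hi h01 hs) (intervalIntegrable_of_mem hi hs h11)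
    have hx1 := x.eq_add_integral_deriv h11
    rw [h1, ← hsplit, ← add_assoc, ← x.eq_add_integral_deriv hs] at hx1
    rw [eq_neg_of_add_eq_zero_left hx1.symm, norm_neg]
    refine (norm_integral_deriv_le hK hx hs.1 hs.2 le_rfl).trans_eq ?_
    rw [intervalIntegral.integral_comp_sub_left (fun s => ‖x s‖) 1, sub_zero]
  refine W1.ext_of_eqOn fun t ht => norm_eq_zero.1 ?_
  simpa using hrev (1 - t) ⟨by linarith [ht.2], by linarith [ht.1]⟩

/-- For bounded measurable `A` and a forcing term in `L^p`, the equation `ẋ = A x + f`, `x(0) = a`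
has a solution in `W^{1,p}`: a fixed point of the Picard operator on `C([0,1])`. The `j`-th iterate
of this operator has Lipschitz constant `K ^ j / j!`, where `K` bounds `A`, so that some iterate is a
contraction. -/
theorem exists_linear_solution [Fact (1 ≤ p)] {A : ℝ → Matrix (Fin n) (Fin n) ℝ}
    (hA : MeasEssBounded A) {f : ℝ → E n} (hf : MemLp f p μI) (a : E n) :
    ∃ x : W1 n p, (∀ᵐ t ∂μI, deriv x t = mulE (A t) (x t) + f t) ∧ x 0 = a := by
  obtain ⟨K, hK0, hK⟩ := hA.exists_norm_mulE_le
  have hmem (x : C(Icc (0 : ℝ) 1, E n)) :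
      MemLp (fun t => mulE (A t) (extendI x t)) p μI := by
    refine hA.memLp_mulE (MemLp.of_bound ?_ ‖x‖ (ae_of_all _ fun t => x.norm_coe_le_norm _))
    exact (x.continuous.Icc_extend' (h := zero_le_one)).aestronglyMeasurable
  have hint (x : C(Icc (0 : ℝ) 1, E n)) :
      IntervalIntegrable (fun t => mulE (A t) (extendI x t) + f t) volume 0 1 :=
    memLp_μI_intervalIntegrable ((hmem x).add hf)
  let T (x : C(Icc (0 : ℝ) 1, E n)) : C(Icc (0 : ℝ) 1, E n) :=
    ⟨fun t => a + ∫ τ in (0 : ℝ)..t, (mulE (A τ) (extendI x τ) + f τ), by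
      have h := (absolutelyContinuousOnInterval_primitive (hint x)).continuousOn
      rw [uIcc_of_le zero_le_one] at h
      exact continuous_const.add h.domRestrict⟩
  have hT (x : C(Icc (0 : ℝ) 1, E n)) {t : ℝ} (ht : t ∈ Icc (0 : ℝ) 1) :
      extendI (T x) t = a + ∫ τ in (0 : ℝ)..t, (mulE (A τ) (extendI x τ) + f τ) :=
    extendI_eq ht
  have hiter (x y : C(Icc (0 : ℝ) 1, E n)) (j : ℕ) : ∀ t ∈ Icc (0 : ℝ) 1,
      ‖extendI (T^[j] x) t - extendI (T^[j] y) t‖ ≤ (K * t) ^ j / j.factorial * dist x y := by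
    induction j with
    | zero =>
      intro t ht
      simpa [extendI_eq ht, ← dist_eq_norm] using ContinuousMap.dist_apply_le_dist _
    | succ j ih =>
      intro t ht
      have h01 : (0 : ℝ) ∈ Icc (0 : ℝ) 1 := by simp
      rw [Function.iterate_succ_apply', Function.iterate_succ_apply', hT _ ht, hT _ ht,
        add_sub_add_left_eq_sub, ← intervalIntegral.integral_sub
          (intervalIntegrable_of_mem (hint _) h01 ht) (intervalIntegrable_of_mem (hint _) h01 ht)]
      have hval : ∫ τ in (0 : ℝ)..t, K * ((K * τ) ^ j / j.factorial * dist x y) =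
          (K * t) ^ (j + 1) / (j + 1).factorial * dist x y := by
        have : ∀ τ : ℝ, K * ((K * τ) ^ j / j.factorial * dist x y) =
            (K ^ (j + 1) / j.factorial * dist x y) * τ ^ j := fun τ => by
          rw [mul_pow]; ring
        simp_rw [this]
        rw [intervalIntegral.integral_const_mul, integral_pow, Nat.factorial_succ]
        push_cast
        field_simp
        ring
      rw [← hval]
      refine intervalIntegral.norm_integral_le_of_norm_le ht.1 ?_
        (Continuous.intervalIntegrable (by fun_prop) _ _)
      rw [ae_restrict_iff' measurableSet_Icc] at hK
      filter_upwards [hK] with τ hτ hmem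
      have hτI : τ ∈ Icc (0 : ℝ) 1 := ⟨hmem.1.le, hmem.2.trans ht.2⟩
      rw [add_sub_add_right_eq_sub, ← mulE_sub]
      exact (hτ hτI _).trans (mul_le_mul_of_nonneg_left (ih τ hτI) hK0)
  obtain ⟨j, hj⟩ := ((FloorSemiring.tendsto_pow_div_factorial_atTop K).eventually
    (gt_mem_nhds zero_lt_one)).exists
  have hKj : 0 ≤ K ^ j / j.factorial := div_nonneg (pow_nonneg hK0 j) (Nat.cast_nonneg _)
  have hcontr : ContractingWith ⟨K ^ j / j.factorial, hKj⟩ T^[j] := by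
    refine ⟨hj, LipschitzWith.of_dist_le_mul fun x y => ?_⟩
    refine (ContinuousMap.dist_le (mul_nonneg hKj dist_nonneg)).2 fun t => ?_
    rw [dist_eq_norm]
    have h := hiter x y j t t.2
    rw [extendI_eq t.2, extendI_eq t.2] at h
    refine h.trans (mul_le_mul_of_nonneg_right ?_ dist_nonneg)
    have h1 : K * (t : ℝ) ≤ K := mul_le_of_le_one_right hK0 t.2.2
    have h2 : 0 ≤ K * (t : ℝ) := mul_nonneg hK0 t.2.1
    change (K * (t : ℝ)) ^ j / j.factorial ≤ K ^ j / j.factorial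
    gcongr
  have hfix := hcontr.isFixedPt_fixedPoint_iterate
  set x := hcontr.fixedPoint T^[j]
  have hx (t : ℝ) (ht : t ∈ Icc (0 : ℝ) 1) :
      extendI x t = a + ∫ τ in (0 : ℝ)..t, (mulE (A τ) (extendI x τ) + f τ) := by
    rw [← hT x ht, hfix.eq]
  obtain ⟨y, hy, hdy⟩ := exists_W1_of_primitive x ((hmem x).add hf) hx
  refine ⟨y, ?_, ?_⟩
  · rw [hy] at hdy ⊢
    exact hdy
  · rw [hy, hx 0 (by simp), intervalIntegral.integral_same, add_zero]

end LinearODE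

/-! ### The adjoint system -/

section Adjoint

variable {n : ℕ} {q : ℝ≥0∞} [Fact (1 ≤ q)]

theorem neg_mulE_transpose {a b : ℕ} (M : Matrix (Fin a) (Fin b) ℝ) (v : E a) :
    -mulE Mᵀ v = mulE (-Mᵀ) v := by
  simp [mulE, Matrix.neg_mulVec]

theorem existsUnique_isAdjointSolution {A : ℝ → Matrix (Fin n) (Fin n) ℝ}
    (hA : MeasEssBounded A) (a : E n) : ∃! v : W1 n q, IsAdjointSolution A a v := by
  have hA' := hA.transpose.neg
  obtain ⟨v, hv, hv0⟩ := exists_linear_solution (p := q) hA' (f := 0) MemLp.zero a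
  refine ⟨v, ⟨hv.mono fun t ht => ?_, hv0⟩, fun w ⟨hw, hw0⟩ => sub_eq_zero.1 ?_⟩
  · rw [ht, neg_mulE_transpose, Pi.zero_apply, add_zero]
  refine eq_zero_of_linear_of_left hA' ?_ ?_
  · filter_upwards [hv, hw, ae_differentiableAt v.2.1, ae_differentiableAt w.2.1] with t h1 h2 h3 h4
    have h : extendI (w - v).1 = extendI w.1 - extendI v.1 := rfl
    rw [h, deriv_sub h4 h3, h1, h2, neg_mulE_transpose, Pi.zero_apply, add_zero, Pi.sub_apply,
      mulE_sub]
  · have h : (w - v) 0 = w 0 - v 0 := rfl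
    rw [h, hw0, hv0, sub_self]

/-- The condition `a = ∫₀¹ Aᵀ v` says that the adjoint solution starting at `a` vanishes at time
`1`, and then it vanishes identically. -/
theorem IsAdjointSolution.eq_zero {A : ℝ → Matrix (Fin n) (Fin n) ℝ} (hA : MeasEssBounded A)
    {a : E n} {v : W1 n q} (hv : IsAdjointSolution A a v)
    (ha : a = ∫ t in (0 : ℝ)..1, mulE (A t)ᵀ (v t)) : v = 0 := by
  obtain ⟨hd, h0⟩ := hv
  refine eq_zero_of_linear_of_right hA.transpose.neg
    (hd.mono fun t ht => by rw [ht, neg_mulE_transpose]) ?_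
  have hint : ∫ t in (0 : ℝ)..1, deriv v t = -∫ t in (0 : ℝ)..1, mulE (A t)ᵀ (v t) := by
    rw [← intervalIntegral.integral_neg]
    refine intervalIntegral.integral_congr_ae ?_
    rw [ae_restrict_iff' measurableSet_Icc] at hd
    filter_upwards [hd] with t ht hmem
    rw [uIoc_of_le zero_le_one] at hmem
    exact ht (Ioc_subset_Icc_self hmem)
  rw [v.eq_add_integral_deriv (by simp), h0, hint, ← ha, add_neg_cancel]

end Adjoint

/-! ### The representation of functionals -/

section Representation

variable {n k : ℕ} {p q : ℝ≥0∞} [Fact (1 ≤ p)] [Fact (1 ≤ q)] [q.HolderConjugate p]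

theorem LpFunctional_zero : LpFunctional p (0 : LpE n q) = 0 := by
  simp [LpFunctional]

theorem pairFunctional_zero : pairFunctional p (0 : E n) (0 : LpE k q) = 0 := by
  ext w <;> simp [pairFunctional, LpFunctional_zero]

/-- An element of `L^q` is determined by its functional on `L^p`, also for `q = ∞`: the test
functions `𝟙_s • c` give `⟨c, ∫_s f⟩ = 0` for all measurable `s` and all vectors `c`. -/
theorem eq_zero_of_LpFunctional_eq_zero {f : LpE n q} (h : LpFunctional p f = 0) : f = 0 := by
  have hfi : Integrable f μI := (Lp.memLp f).integrable Fact.out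
  rw [Lp.eq_zero_iff_ae_eq_zero]
  refine hfi.ae_eq_zero_of_forall_setIntegral_eq_zero fun s hs hμs => ?_
  refine ext_inner_left ℝ fun c => ?_
  rw [inner_zero_right, ← integral_inner hfi.integrableOn, ← integral_indicator hs]
  have hzero := LpFunctional_apply f (indicatorConstLp p hs hμs.ne c)
  rw [h, zero_apply, intervalIntegral.integral_of_le zero_le_one,
    ← integral_Icc_eq_integral_Ioc] at hzero
  rw [hzero]
  refine integral_congr_ae ?_
  filter_upwards [indicatorConstLp_coeFn (p := p) (hs := hs) (hμs := hμs.ne) (c := c)] with t ht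
  rw [ht]
  by_cases hts : t ∈ s <;> simp [hts, real_inner_comm]

theorem eq_zero_of_pairFunctional_eq_zero {a : E n} {f : LpE k q}
    (h : pairFunctional p a f = 0) : a = 0 ∧ f = 0 := by
  constructor
  · have h' := congrArg (fun φ : StrongDual ℝ (E n × LpE k p) => φ (a, 0)) h
    simpa [pairFunctional] using h'
  · refine eq_zero_of_LpFunctional_eq_zero (p := p) (ContinuousLinearMap.ext fun θ => ?_)
    have h' := congrArg (fun φ : StrongDual ℝ (E n × LpE k p) => φ (0, θ)) h
    simpa [pairFunctional] using h'

end Representation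

/-! ### The effective domain of the optimal value function -/

section Domain

/-- If the effective domain is the whole space, a singular subgradient is nonpositive in every
direction `d` and in `-d`. -/
theorem singularSubdifferential_eq_zero {X : Type*} [NormedAddCommGroup X] [NormedSpace ℝ X]
    {f : X → EReal} (hf : ∀ w, f w < ⊤) (a : X) : singularSubdifferential f a = {0} := by
  ext φ
  simp only [singularSubdifferential, normalCone, mem_ofPred_eq, mem_singleton_iff]
  refine ⟨fun ⟨_, h⟩ => ?_, fun h => ⟨hf a, fun z _ => by simp [h]⟩⟩
  have hle (d : X) : φ d ≤ 0 := by
    obtain ⟨r, hr, -⟩ := EReal.lt_iff_exists_real_btwn.1 (hf (a + d))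
    simpa using h (a + d, r) hr.le
  refine ContinuousLinearMap.ext fun d => le_antisymm (hle d) ?_
  simpa using hle (-d)

variable {n m k : ℕ} {p : ℝ≥0∞} [Fact (1 ≤ p)]

/-- Every control and every parameter determine a trajectory, so that the problem is feasible for
all parameters as soon as there is an admissible control. -/
theorem optimalValue_lt_top {A : ℝ → Matrix (Fin n) (Fin n) ℝ}
    {B : ℝ → Matrix (Fin n) (Fin m) ℝ} {C : ℝ → Matrix (Fin n) (Fin k) ℝ}
    (hA : MeasEssBounded A) (hB : MeasEssBounded B) (hC : MeasEssBounded C)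
    (g : E n → ℝ) (L : ℝ → E n → E m → E k → ℝ) {𝒰 : Set (LpE m p)} (h𝒰 : 𝒰.Nonempty)
    (w : E n × LpE k p) : optimalValue A B C g L 𝒰 w < ⊤ := by
  obtain ⟨u, hu⟩ := h𝒰
  obtain ⟨x, hx, hx0⟩ := exists_linear_solution hA
    ((hB.memLp_mulE (Lp.memLp u)).add (hC.memLp_mulE (Lp.memLp w.2))) w.1
  have hfeas : (x, u) ∈ feasibleSet A B C 𝒰 w := by
    refine ⟨⟨hx.mono fun t ht => ?_, hx0⟩, mem_univ _, hu⟩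
    rw [ht, Pi.add_apply, add_assoc]
  exact (iInf₂_le (x, u) hfeas).trans_lt (EReal.coe_lt_top _)

end Domain

end OptControl

/-! ### The singular subdifferential of the optimal value function -/

theorem mainTheorem2 {n m k : ℕ} {p q : ℝ≥0∞} [Fact (1 ≤ p)] [Fact (1 ≤ q)]
    [q.HolderConjugate p] (hp : p ≠ ⊤)
    (A : ℝ → Matrix (Fin n) (Fin n) ℝ) (B : ℝ → Matrix (Fin n) (Fin m) ℝ)
    (C : ℝ → Matrix (Fin n) (Fin k) ℝ)
    (g : OptControl.E n → ℝ)
    (L : ℝ → OptControl.E n → OptControl.E m → OptControl.E k → ℝ)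
    (𝒰 : Set (OptControl.LpE m p)) (hconv : Convex ℝ 𝒰) (hint : (interior 𝒰).Nonempty)
    (hA : OptControl.MeasEssBounded A) (hB : OptControl.MeasEssBounded B)
    (hC : OptControl.MeasEssBounded C)
    (hcost : OptControl.CostAssumption p g L)
    (hker : OptControl.KernelAssumption q A B C)
    (hrange : OptControl.ClosedRangeAssumption p A B C)
    (wbar : OptControl.E n × OptControl.LpE k p)
    (hfin : OptControl.optimalValue A B C g L 𝒰 wbar ≠ ⊤ ∧
      OptControl.optimalValue A B C g L 𝒰 wbar ≠ ⊥)
    (xbar : OptControl.W1 n p) (ubar : OptControl.LpE m p)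
    (hsol : (xbar, ubar) ∈ OptControl.solutionSet A B C g L 𝒰 wbar)
    (αs : OptControl.E n) (θs : OptControl.LpE k q) :
    (∃! v : OptControl.W1 n q, OptControl.IsAdjointSolution A αs v) ∧
    (OptControl.pairFunctional p αs θs ∈
        OptControl.singularSubdifferential (OptControl.optimalValue A B C g L 𝒰) wbar ↔
      ∃ v : OptControl.W1 n q, OptControl.IsAdjointSolution A αs v ∧
        αs = ∫ t in (0 : ℝ)..1, OptControl.mulE (A t)ᵀ (v t) ∧
        (∀ᵐ t ∂OptControl.μI, θs t = OptControl.mulE (C t)ᵀ (v t)) ∧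
        ∃ us : OptControl.LpE m q,
          (∀ᵐ t ∂OptControl.μI, us t = -OptControl.mulE (B t)ᵀ (v t)) ∧
          OptControl.LpFunctional p us ∈ OptControl.normalCone ubar 𝒰) := by
  have hdom := OptControl.optimalValue_lt_top hA hB hC g L (hint.mono interior_subset)
  rw [OptControl.singularSubdifferential_eq_zero hdom, mem_singleton_iff]
  refine ⟨OptControl.existsUnique_isAdjointSolution hA αs, fun h => ?_, ?_⟩
  · obtain ⟨rfl, rfl⟩ := OptControl.eq_zero_of_pairFunctional_eq_zero h
    have hv (t : ℝ) : (0 : OptControl.W1 n q) t = 0 := rfl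
    refine ⟨0, ⟨ae_of_all _ fun t => ?_, rfl⟩, ?_, ?_, 0, ?_, ?_⟩
    · have h0 : OptControl.extendI (0 : OptControl.W1 n q).1 = fun _ => 0 := rfl
      rw [h0, deriv_const, OptControl.mulE_zero, neg_zero]
    · simp only [hv, OptControl.mulE_zero, intervalIntegral.integral_zero]
    · filter_upwards [Lp.coeFn_zero (OptControl.E k) q OptControl.μI] with t ht
      rw [ht, hv, OptControl.mulE_zero, Pi.zero_apply]
    · filter_upwards [Lp.coeFn_zero (OptControl.E m) q OptControl.μI] with t ht
      rw [ht, hv, OptControl.mulE_zero, Pi.zero_apply, neg_zero]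
    · intro u _
      rw [OptControl.LpFunctional_zero, zero_apply]
  · rintro ⟨v, hv, hα, hθ, -⟩
    obtain rfl : v = 0 := hv.eq_zero hA hα
    obtain rfl : (0 : OptControl.E n) = αs := hv.2
    obtain rfl : θs = 0 := by
      rw [Lp.eq_zero_iff_ae_eq_zero]
      filter_upwards [hθ] with t ht
      rw [ht]
      exact OptControl.mulE_zero _
    exact OptControl.pairFunctional_zero
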